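/- Let $G$ be a compact Lie group, let $U$ and $V$ be strongly continuous unitary representations of $G$ on complex Hilbert spaces $\mathcal H$ and $\mathcal K$ (of arbitrary dimension, possibly equal), and let $\psi\in\mathcal H$ and $\phi\in\mathcal K$ be unit vectors. A quantum channel from $\mathcal H$ to $\mathcal K$ is a linear, completely positive, trace-preserving map $\mathcal E$ from the trace class operators on $\mathcal H$ to those on $\mathcal K$; it is $G$-covariant if $\mathcal E(U(g)AU(g)^\dagger)=V(g)\mathcal E(A)V(g)^\dagger$ for all $g\in G$ and all trace class $A$, and similarly with the roles of $(\mathcal H,U)$ and $(\mathcal K,V)$ exchanged. The pure states $\psi$ and $\phi$ are called $G$-equivalent if some $G$-covariant channel from $\mathcal H$ to $\mathcal K$ maps $|\psi\rangle\langle\psi|$ to $|\phi\rangle\langle\phi|$ and some $G$-covariant channel from $\mathcal K$ to $\mathcal H$ maps $|\phi\rangle\langle\phi|$ to $|\psi\rangle\langle\psi|$. Put $\chi_\psi(g)=\langle\psi|U(g)|\psi\rangle$ and $\chi_\phi(g)=\langle\phi|V(g)|\phi\rangle$. Consider the condition $(\ast)$ there is a 1-dimensional unitary representation of $G$, that is,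 a continuous homomorphism $g\mapsto e^{i\Theta(g)}$ from $G$ to the unit circle, such that $\chi_\psi(g)=\chi_\phi(g)\,e^{i\Theta(g)}$ for all $g\in G$. Then $(\ast)$ implies that $\psi$ and $\phi$ are $G$-equivalent. If moreover $G$ is connected, or $\chi_\psi$ and $\chi_\phi$ vanish nowhere on $G$, then $\psi$ and $\phi$ are $G$-equivalent if and only if $(\ast)$ holds. -/

import Mathlib

open scoped InnerProductSpace ComplexOrder ContDiff Manifold

noncomputable section

namespace Asymmetry

section TraceClass

variable {H : Type*} [NormedAddCommGroup H] [InnerProductSpace ℂ H]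

/-- `A = ∑ₙ |xₙ⟩⟨yₙ|` with `∑ₙ ‖xₙ‖ ‖yₙ‖ < ∞`. -/
structure IsNuclearExpansion (A : H →L[ℂ] H) (x y : ℕ → H) : Prop where
  summable : Summable fun n => ‖x n‖ * ‖y n‖
  hasSum : ∀ v, HasSum (fun n => ⟪y n, v⟫_ℂ • x n) (A v)

/-- An operator on a Hilbert space is trace class iff it is nuclear, that is, an absolutely
convergent sum of operators of rank at most one. On a finite-dimensional space every operator is
trace class. -/
def IsTraceClass (A : H →L[ℂ] H) : Prop :=
  ∃ x y : ℕ → H, IsNuclearExpansion A x y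

theorem IsTraceClass.rankOne (x y : H) : IsTraceClass (InnerProductSpace.rankOne ℂ x y) := by
  refine ⟨Pi.single 0 x, Pi.single 0 y, ?_, fun v => ?_⟩
  · refine summable_of_ne_finset_zero (s := {0}) fun n hn => ?_
    have hn : n ≠ 0 := by simpa using hn
    simp [hn]
  · have h := hasSum_single (f := fun n => ⟪(Pi.single 0 y : ℕ → H) n, v⟫_ℂ •
        (Pi.single 0 x : ℕ → H) n) 0 fun n hn => by simp [hn]
    simpa using h

theorem IsTraceClass.add {A B : H →L[ℂ] H} (hA : IsTraceClass A) (hB : IsTraceClass B) :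
    IsTraceClass (A + B) := by
  obtain ⟨x, y, hxy⟩ := hA
  obtain ⟨x', y', hxy'⟩ := hB
  have e0 : ∀ k : ℕ, Even (2 * k) := fun k => even_two_mul k
  have e1 : ∀ k : ℕ, ¬ Even (2 * k + 1) := fun k => by simp
  have d0 : ∀ k : ℕ, 2 * k / 2 = k := fun k => by omega
  have d1 : ∀ k : ℕ, (2 * k + 1) / 2 = k := fun k => by omega
  refine ⟨fun n => if Even n then x (n / 2) else x' (n / 2),
    fun n => if Even n then y (n / 2) else y' (n / 2), ?_, fun v => ?_⟩
  · refine Summable.even_add_odd ?_ ?_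
    · simpa only [e0, d0, if_true] using hxy.summable
    · simpa only [e1, d1, if_false] using hxy'.summable
  · refine HasSum.even_add_odd ?_ ?_
    · simpa [e0, d0] using hxy.hasSum v
    · simpa [e1, d1] using hxy'.hasSum v

theorem IsTraceClass.smul {A : H →L[ℂ] H} (c : ℂ) (hA : IsTraceClass A) :
    IsTraceClass (c • A) := by
  obtain ⟨x, y, hxy⟩ := hA
  refine ⟨fun n => c • x n, y, ?_, fun v => ?_⟩
  · simpa only [norm_smul, mul_assoc] using hxy.summable.mul_left ‖c‖
  · simpa [smul_comm c] using (hxy.hasSum v).const_smul c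

theorem IsTraceClass.conj [CompleteSpace H] {K : Type*} [NormedAddCommGroup K]
    [InnerProductSpace ℂ K] [CompleteSpace K] {A : H →L[ℂ] H} (T : H →L[ℂ] K)
    (hA : IsTraceClass A) : IsTraceClass (T ∘L A ∘L ContinuousLinearMap.adjoint T) := by
  obtain ⟨x, y, hxy⟩ := hA
  refine ⟨fun n => T (x n), fun n => T (y n), ?_, fun v => ?_⟩
  · refine Summable.of_nonneg_of_le (fun n => by positivity) (fun n => ?_)
      (hxy.summable.mul_left (‖T‖ * ‖T‖))
    calc ‖T (x n)‖ * ‖T (y n)‖ ≤ (‖T‖ * ‖x n‖) * (‖T‖ * ‖y n‖) := by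
          gcongr <;> exact T.le_opNorm _
      _ = ‖T‖ * ‖T‖ * (‖x n‖ * ‖y n‖) := by ring
  · have h := (hxy.hasSum (ContinuousLinearMap.adjoint T v)).mapL T
    simpa [ContinuousLinearMap.adjoint_inner_right] using h

variable (H) in
/-- The complex vector space of trace class operators on `H`. -/
def traceClass : Submodule ℂ (H →L[ℂ] H) where
  carrier := {A | IsTraceClass A}
  add_mem' := IsTraceClass.add
  zero_mem' := by simpa using IsTraceClass.rankOne (0 : H) 0
  smul_mem' c _ h := IsTraceClass.smul c h

/-- The diagonal of a trace class operator in any orthonormal basis is summable, and its sum does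
not depend on the basis. -/
theorem IsNuclearExpansion.hasSum_diagonal {A : H →L[ℂ] H} {x y : ℕ → H}
    (h : IsNuclearExpansion A x y) {ι : Type*} (b : HilbertBasis ι ℂ H) :
    HasSum (fun i => ⟪b i, A (b i)⟫_ℂ) (∑' n, ⟪y n, x n⟫_ℂ) := by
  have hrow : ∀ n, HasSum (fun i => ⟪y n, b i⟫_ℂ * ⟪b i, x n⟫_ℂ) ⟪y n, x n⟫_ℂ := fun n =>
    b.hasSum_inner_mul_inner (y n) (x n)
  have hsq : ∀ v : H, HasSum (fun i => ‖⟪b i, v⟫_ℂ‖ ^ 2) (‖v‖ ^ 2) := fun v => by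
    have h1 := (b.hasSum_inner_mul_inner v v).mapL Complex.reCLM
    have h2 : Complex.reCLM ⟪v, v⟫_ℂ = ‖v‖ ^ 2 := by
      simpa using inner_self_eq_norm_sq (𝕜 := ℂ) v
    rw [h2] at h1
    refine h1.congr_fun fun i => ?_
    rw [← inner_conj_symm v (b i), ← Complex.normSq_eq_conj_mul_self, Complex.reCLM_apply,
      Complex.ofReal_re, Complex.normSq_eq_norm_sq]
  have hsum : Summable fun p : ℕ × ι => ⟪y p.1, b p.2⟫_ℂ * ⟪b p.2, x p.1⟫_ℂ := by
    apply Summable.of_norm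
    have hfin : ∀ (n : ℕ) (s : Finset ι),
        ∑ i ∈ s, ‖⟪y n, b i⟫_ℂ * ⟪b i, x n⟫_ℂ‖ ≤ ‖x n‖ * ‖y n‖ := fun n s => by
      have hle : ∀ v : H, √(∑ i ∈ s, ‖⟪b i, v⟫_ℂ‖ ^ 2) ≤ ‖v‖ := fun v =>
        Real.sqrt_le_iff.2 ⟨norm_nonneg v, sum_le_hasSum s (fun i _ => by positivity) (hsq v)⟩
      calc ∑ i ∈ s, ‖⟪y n, b i⟫_ℂ * ⟪b i, x n⟫_ℂ‖
          = ∑ i ∈ s, ‖⟪b i, x n⟫_ℂ‖ * ‖⟪b i, y n⟫_ℂ‖ := by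
            refine Finset.sum_congr rfl fun i _ => ?_
            rw [norm_mul, norm_inner_symm (y n) (b i), mul_comm]
        _ ≤ √(∑ i ∈ s, ‖⟪b i, x n⟫_ℂ‖ ^ 2) * √(∑ i ∈ s, ‖⟪b i, y n⟫_ℂ‖ ^ 2) :=
            Real.sum_mul_le_sqrt_mul_sqrt s _ _
        _ ≤ ‖x n‖ * ‖y n‖ := by gcongr <;> apply hle
    have hrows : ∀ n, Summable fun i => ‖⟪y n, b i⟫_ℂ * ⟪b i, x n⟫_ℂ‖ := fun n =>
      summable_of_sum_le (fun i => norm_nonneg _) (hfin n)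
    refine (summable_prod_of_nonneg fun p => norm_nonneg _).2 ⟨hrows, ?_⟩
    exact Summable.of_nonneg_of_le (fun n => tsum_nonneg fun i => norm_nonneg _)
      (fun n => (hrows n).tsum_le_of_sum_le (hfin n)) h.summable
  have hcol : ∀ i, HasSum (fun n => ⟪y n, b i⟫_ℂ * ⟪b i, x n⟫_ℂ) ⟪b i, A (b i)⟫_ℂ := fun i => by
    simpa [inner_smul_right] using (h.hasSum (b i)).mapL (innerSL ℂ (b i))
  rw [(hsum.hasSum.prod_fiberwise hrow).tsum_eq]
  exact ((Equiv.prodComm ι ℕ).hasSum_iff.2 hsum.hasSum).prod_fiberwise hcol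

variable [CompleteSpace H]

/-- The trace `tr A = ∑ᵢ ⟨bᵢ|A|bᵢ⟩` over an orthonormal basis of `H`; for trace class `A` the choice
of the basis is immaterial, see `IsNuclearExpansion.hasSum_diagonal`. -/
def trace (A : H →L[ℂ] H) : ℂ :=
  ∑' i, ⟪(exists_hilbertBasis ℂ H).choose_spec.choose i,
    A ((exists_hilbertBasis ℂ H).choose_spec.choose i)⟫_ℂ

/-- `T A T†` as a trace class operator, for bounded `T`. -/
def conjBy (T : H →L[ℂ] H) (A : traceClass H) : traceClass H :=
  ⟨T ∘L (A : H →L[ℂ] H) ∘L ContinuousLinearMap.adjoint T, IsTraceClass.conj T A.2⟩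

/-- The operator `|ψ⟩⟨ψ|`, the density operator of the pure state given by a unit vector `ψ`. -/
def pureState (ψ : H) : traceClass H :=
  ⟨InnerProductSpace.rankOne ℂ ψ ψ, IsTraceClass.rankOne ψ ψ⟩

end TraceClass

section Channels

variable {H K : Type*}
  [NormedAddCommGroup H] [InnerProductSpace ℂ H] [CompleteSpace H]
  [NormedAddCommGroup K] [InnerProductSpace ℂ K] [CompleteSpace K]

/-- The block operator with entries `A i j` is positive on the `n`-fold direct sum of `H`. -/
def IsPositiveBlock {n : ℕ} (A : Fin n → Fin n → traceClass H) : Prop :=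
  ∀ v : Fin n → H, 0 ≤ ∑ i, ∑ j, ⟪v i, (A i j : H →L[ℂ] H) (v j)⟫_ℂ

/-- A quantum channel: a linear, completely positive, trace preserving map from the trace class
operators on `H` to those on `K`. Complete positivity says that for all `n` the map applied entrywise
sends positive `n × n` block operators to positive ones. -/
structure IsQuantumChannel (Φ : traceClass H →ₗ[ℂ] traceClass K) : Prop where
  completelyPositive : ∀ (n : ℕ) (A : Fin n → Fin n → traceClass H),
    IsPositiveBlock A → IsPositiveBlock fun i j => Φ (A i j)
  tracePreserving : ∀ A : traceClass H, trace (Φ A : K →L[ℂ] K) = trace (A : H →L[ℂ] H)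

end Channels

section Symmetry

/-- A (strongly continuous) unitary representation of the topological group `G` on `H`. -/
structure UnitaryRep (G H : Type*) [Group G] [TopologicalSpace G]
    [NormedAddCommGroup H] [InnerProductSpace ℂ H] [CompleteSpace H] where
  toHom : G →* unitary (H →L[ℂ] H)
  continuous_apply : ∀ v : H, Continuous fun g => (toHom g : H →L[ℂ] H) v

variable {G H K : Type*} [Group G] [TopologicalSpace G]
  [NormedAddCommGroup H] [InnerProductSpace ℂ H] [CompleteSpace H]
  [NormedAddCommGroup K] [InnerProductSpace ℂ K] [CompleteSpace K]

/-- The operator `U(g)`. -/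
def UnitaryRep.op (U : UnitaryRep G H) (g : G) : H →L[ℂ] H := U.toHom g

/-- `Φ(U(g) A U(g)†) = V(g) Φ(A) V(g)†` for all `g` and `A`. -/
def IsCovariant (U : UnitaryRep G H) (V : UnitaryRep G K)
    (Φ : traceClass H →ₗ[ℂ] traceClass K) : Prop :=
  ∀ (g : G) (A : traceClass H), Φ (conjBy (U.op g) A) = conjBy (V.op g) (Φ A)

/-- Some `G`-covariant quantum channel takes `ρ` to `σ`. -/
def CovariantlyConvertible (U : UnitaryRep G H) (V : UnitaryRep G K)
    (ρ : traceClass H) (σ : traceClass K) : Prop :=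
  ∃ Φ : traceClass H →ₗ[ℂ] traceClass K, IsQuantumChannel Φ ∧ IsCovariant U V Φ ∧ Φ ρ = σ

/-- `G`-equivalence: convertibility by `G`-covariant channels in both directions. -/
def GEquivalent (U : UnitaryRep G H) (V : UnitaryRep G K)
    (ρ : traceClass H) (σ : traceClass K) : Prop :=
  CovariantlyConvertible U V ρ σ ∧ CovariantlyConvertible V U σ ρ

/-- The characteristic function `χ_ψ(g) = ⟨ψ|U(g)|ψ⟩`. -/
def charFunction (U : UnitaryRep G H) (ψ : H) (g : G) : ℂ :=
  ⟪ψ, U.op g ψ⟫_ℂ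

end Symmetry

end Asymmetry

end

open Asymmetry

/-!
A covariant channel `Φ` with `|ψ⟩⟨ψ| ↦ |φ⟩⟨φ|` sends the block operator with entries
`|U(g)ψ⟩⟨U(h)ψ|` to a positive one with diagonal `|V(g)φ⟩⟨V(g)φ|`, which forces its entries to be
`f(h⁻¹g) |V(g)φ⟩⟨V(h)φ|` for a normalized positive definite `f`, and comparing traces gives
`χ_ψ = χ_φ f`. Channels in both directions make `|f| = 1` wherever `χ_ψ ≠ 0`. The set `|f| = 1` is a
subgroup on which `f` is multiplicative; it is a neighbourhood of `1`, so it is all of a connected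
group.

Conversely, replacing `V` by `η ⊗ V` reduces to `χ_ψ = χ_φ`. Then `U(g)ψ ↦ V(g)φ` preserves inner
products and extends to a partial isometry `W` which intertwines `U` and `V` and is supported on the
cyclic subspace `M` of `ψ`. The channel applies `W` on `M` and on the orthogonal complement
prepares a `G`-invariant state `τ`. Such a `τ` is the normalized projection onto a finite-dimensional
invariant subspace, obtained as an eigenspace of the Haar average of a rank one projection.
-/

namespace Asymmetry

section PosSemidef

open Matrix

theorem posSemidef_of_dotProduct_mulVec_nonneg {ι : Type*} [Fintype ι] {M : Matrix ι ι ℂ}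
    (h : ∀ x, 0 ≤ star x ⬝ᵥ (M *ᵥ x)) : M.PosSemidef := by
  classical
  rw [← isPositive_toEuclideanLin_iff, LinearMap.isPositive_iff_complex]
  intro x
  have hx : ⟪M.toEuclideanLin x, x⟫_ℂ = star x.ofLp ⬝ᵥ (M *ᵥ x.ofLp) := by
    rw [← (h x.ofLp).isSelfAdjoint.star_eq, star_dotProduct, star_star, dotProduct_comm]
    rfl
  obtain ⟨r, hr, hxr⟩ := RCLike.nonneg_iff_exists_ofReal.1 (h x.ofLp)
  rw [hx, ← hxr]
  exact ⟨by simp, by simpa using hr⟩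

variable {ι 𝕜 : Type*} [RCLike 𝕜] {M : Matrix ι ι 𝕜}

theorem posSemidef_of_forall_fin_submatrix
    (h : ∀ (n : ℕ) (e : Fin n → ι), (M.submatrix e e).PosSemidef) : M.PosSemidef := by
  refine ⟨IsHermitian.ext fun i j => (h 2 ![i, j]).isHermitian.apply 0 1, fun x => ?_⟩
  have hx := (h _ ((↑) ∘ x.support.equivFin.symm)).dotProduct_mulVec_nonneg
    fun k => x (x.support.equivFin.symm k)
  convert hx using 1
  simp only [Finsupp.sum, dotProduct, mulVec, Finset.mul_sum, ← x.support.sum_coe_sort,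
    ← x.support.equivFin.symm.sum_comp]
  simp [mul_assoc]

theorem apply_eq_zero_of_posSemidef (hM : M.PosSemidef) {i : ι} (hi : M i i = 0) (j : ι) :
    M j i = 0 := by
  have hker := ((hM.submatrix ![j, i]).dotProduct_mulVec_zero_iff ![0, 1]).1 (by
    simp [dotProduct, mulVec, Fin.sum_univ_two, hi])
  simpa [mulVec, dotProduct, Fin.sum_univ_two] using congrFun hker 0

theorem norm_apply_le_one_of_posSemidef (hM : M.PosSemidef) (hdiag : ∀ i, M i i = 1) (i j : ι) :
    ‖M i j‖ ≤ 1 := by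
  have hdet := (hM.submatrix ![i, j]).det_nonneg
  have h : (0 : 𝕜) ≤ ((1 - ‖M i j‖ ^ 2 : ℝ) : 𝕜) := by
    rw [det_fin_two] at hdet
    simpa [hdiag, ← hM.isHermitian.apply j i, RCLike.mul_conj] using hdet
  rwa [RCLike.ofReal_nonneg, sub_nonneg, sq_le_one_iff₀ (norm_nonneg _)] at h

theorem apply_eq_mul_of_posSemidef (hM : M.PosSemidef) (hdiag : ∀ i, M i i = 1) {i j : ι}
    (hij : ‖M i j‖ = 1) (k : ι) : M k j = M k i * M i j := by
  have hji : M j i * M i j = 1 := by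
    rw [← hM.isHermitian.apply j i, RCLike.star_def, RCLike.conj_mul, hij]
    simp
  have hker := ((hM.submatrix ![j, i, k]).dotProduct_mulVec_zero_iff ![1, -M i j, 0]).1 (by
    simp [dotProduct, mulVec, Fin.sum_univ_succ, hdiag, hji])
  have hk : M k j + -(M k i * M i j) = 0 := by
    simpa [mulVec, dotProduct, Fin.sum_univ_succ] using congrFun hker 2
  exact add_neg_eq_zero.1 hk

end PosSemidef

section Trace

open ContinuousLinearMap (adjoint)

variable {H K L : Type*}
  [NormedAddCommGroup H] [InnerProductSpace ℂ H] [CompleteSpace H]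
  [NormedAddCommGroup K] [InnerProductSpace ℂ K] [CompleteSpace K]
  [NormedAddCommGroup L] [InnerProductSpace ℂ L] [CompleteSpace L]

theorem IsNuclearExpansion.hasSum_trace {A : H →L[ℂ] H} {x y : ℕ → H}
    (h : IsNuclearExpansion A x y) : HasSum (fun n => ⟪y n, x n⟫_ℂ) (trace A) := by
  have hs : Summable fun n => ⟪y n, x n⟫_ℂ :=
    .of_norm_bounded h.summable fun n => mul_comm ‖x n‖ _ ▸ norm_inner_le_norm _ _
  convert hs.hasSum
  exact (h.hasSum_diagonal _).tsum_eq

theorem hasSum_trace {ι : Type*} (b : HilbertBasis ι ℂ H) (A : traceClass H) :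
    HasSum (fun i => ⟪b i, (A : H →L[ℂ] H) (b i)⟫_ℂ) (trace (A : H →L[ℂ] H)) := by
  obtain ⟨x, y, h⟩ := A.2
  exact h.hasSum_trace.tsum_eq ▸ h.hasSum_diagonal b

variable (H) in
/-- The trace as a linear functional on the trace class operators. -/
noncomputable def traceLinearMap : traceClass H →ₗ[ℂ] ℂ where
  toFun A := trace (A : H →L[ℂ] H)
  map_add' A B := by
    obtain ⟨_, b, -⟩ := exists_hilbertBasis ℂ H
    refine (hasSum_trace b (A + B)).unique ?_
    simpa [inner_add_right] using (hasSum_trace b A).add (hasSum_trace b B)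
  map_smul' c A := by
    obtain ⟨_, b, -⟩ := exists_hilbertBasis ℂ H
    refine (hasSum_trace b (c • A)).unique ?_
    simpa [inner_smul_right] using (hasSum_trace b A).mul_left c

/-- The operator `|x⟩⟨y|`, as a trace class operator. -/
noncomputable def ketBra (x y : H) : traceClass H :=
  ⟨InnerProductSpace.rankOne ℂ x y, IsTraceClass.rankOne x y⟩

omit [CompleteSpace H] in
@[simp]
theorem ketBra_apply (x y v : H) : (ketBra x y : H →L[ℂ] H) v = ⟪y, v⟫_ℂ • x :=
  rfl

omit [CompleteSpace H] in
theorem pureState_eq_ketBra (ψ : H) : pureState ψ = ketBra ψ ψ :=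
  rfl

theorem traceLinearMap_ketBra (x y : H) : traceLinearMap H (ketBra x y) = ⟪y, x⟫_ℂ := by
  obtain ⟨_, b, -⟩ := exists_hilbertBasis ℂ H
  refine (hasSum_trace b _).unique ?_
  simpa [inner_smul_right] using b.hasSum_inner_mul_inner y x

/-- The completely positive map `A ↦ T A T†` with the single Kraus operator `T`. -/
noncomputable def krausMap (T : H →L[ℂ] K) : traceClass H →ₗ[ℂ] traceClass K where
  toFun A := ⟨T ∘L (A : H →L[ℂ] H) ∘L adjoint T, IsTraceClass.conj T A.2⟩
  map_add' A B := by ext v; simp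
  map_smul' c A := by ext v; simp

theorem krausMap_apply_apply (T : H →L[ℂ] K) (A : traceClass H) (v : K) :
    (krausMap T A : K →L[ℂ] K) v = T ((A : H →L[ℂ] H) (adjoint T v)) :=
  rfl

theorem conjBy_eq_krausMap (T : H →L[ℂ] H) (A : traceClass H) : conjBy T A = krausMap T A :=
  rfl

theorem krausMap_krausMap (S : K →L[ℂ] L) (T : H →L[ℂ] K) (A : traceClass H) :
    krausMap S (krausMap T A) = krausMap (S ∘L T) A := by
  ext v
  simp only [krausMap_apply_apply, ContinuousLinearMap.adjoint_comp,
    ContinuousLinearMap.comp_apply]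

theorem krausMap_circle_smul (z : Circle) (T : H →L[ℂ] K) :
    krausMap ((z : ℂ) • T) = krausMap T := by
  ext A v
  simp [krausMap_apply_apply, map_smulₛₗ, smul_smul, ← Circle.coe_inv_eq_conj]

theorem krausMap_ketBra (T : H →L[ℂ] K) (x y : H) :
    krausMap T (ketBra x y) = ketBra (T x) (T y) := by
  ext v
  simp [krausMap_apply_apply, ContinuousLinearMap.adjoint_inner_right]

theorem IsNuclearExpansion.hasSum_traceLinearMap_krausMap {A : traceClass H} {x y : ℕ → H}
    (h : IsNuclearExpansion (A : H →L[ℂ] H) x y) (T : H →L[ℂ] K) :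
    HasSum (fun n => ⟪T (y n), T (x n)⟫_ℂ) (traceLinearMap K (krausMap T A)) := by
  refine IsNuclearExpansion.hasSum_trace (A := (krausMap T A : K →L[ℂ] K)) ⟨?_, fun v => ?_⟩
  · refine .of_nonneg_of_le (fun n => by positivity) (fun n => ?_)
      (h.summable.mul_left (‖T‖ * ‖T‖))
    grw [T.le_opNorm, T.le_opNorm, mul_mul_mul_comm]
  · simpa [krausMap_apply_apply, ContinuousLinearMap.adjoint_inner_right] using
      (h.hasSum (adjoint T v)).mapL T

theorem traceLinearMap_krausMap_of_isometry {T : H →L[ℂ] K} (hT : adjoint T ∘L T = .id ℂ H)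
    (A : traceClass H) : traceLinearMap K (krausMap T A) = traceLinearMap H A := by
  obtain ⟨x, y, hA⟩ := A.2
  refine (hA.hasSum_traceLinearMap_krausMap T).unique ?_
  have hxy (n : ℕ) : ⟪T (y n), T (x n)⟫_ℂ = ⟪y n, x n⟫_ℂ := by
    rw [← ContinuousLinearMap.adjoint_inner_right]
    exact congrArg _ (DFunLike.congr_fun hT (x n))
  simpa only [hxy] using! hA.hasSum_trace

theorem traceLinearMap_krausMap_add {S : H →L[ℂ] K} {T : H →L[ℂ] L}
    (hST : adjoint S ∘L S + adjoint T ∘L T = .id ℂ H) (A : traceClass H) :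
    traceLinearMap K (krausMap S A) + traceLinearMap L (krausMap T A) = traceLinearMap H A := by
  obtain ⟨x, y, hA⟩ := A.2
  refine ((hA.hasSum_traceLinearMap_krausMap S).add
    (hA.hasSum_traceLinearMap_krausMap T)).unique ?_
  have hxy (n : ℕ) : ⟪S (y n), S (x n)⟫_ℂ + ⟪T (y n), T (x n)⟫_ℂ = ⟪y n, x n⟫_ℂ := by
    rw [← ContinuousLinearMap.adjoint_inner_right, ← ContinuousLinearMap.adjoint_inner_right,
      ← inner_add_right]
    exact congrArg _ (DFunLike.congr_fun hST (x n))
  simpa only [hxy] using! hA.hasSum_trace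

end Trace

section PositiveBlock

open Matrix (of mulVec)

variable {H K : Type*}
  [NormedAddCommGroup H] [InnerProductSpace ℂ H]
  [NormedAddCommGroup K] [InnerProductSpace ℂ K]
  {n : ℕ} {A B : Fin n → Fin n → traceClass H}

theorem isPositiveBlock_iff_posSemidef :
    IsPositiveBlock A ↔
      ∀ v : Fin n → H, (of fun i j => ⟪v i, (A i j : H →L[ℂ] H) (v j)⟫_ℂ).PosSemidef := by
  refine ⟨fun hA v => posSemidef_of_dotProduct_mulVec_nonneg fun c => ?_, fun hA v => ?_⟩
  · simpa [dotProduct, mulVec, inner_smul_left, inner_smul_right, Finset.mul_sum, mul_assoc,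
      mul_comm, mul_left_comm] using hA fun i => c i • v i
  · simpa [dotProduct, mulVec] using (hA v).dotProduct_mulVec_nonneg 1

theorem posSemidef_inner_apply_of_isPositive [CompleteSpace H] {T : H →L[ℂ] H}
    (hT : T.IsPositive) (v : Fin n → H) : (of fun i j => ⟪v i, T (v j)⟫_ℂ).PosSemidef := by
  refine posSemidef_of_dotProduct_mulVec_nonneg fun c => ?_
  have h := hT.inner_nonneg_right (∑ i, c i • v i)
  rw [sum_inner] at h
  simpa [dotProduct, mulVec, inner_sum, inner_smul_left, inner_smul_right, Finset.mul_sum,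
    mul_assoc, mul_comm, mul_left_comm] using h

theorem isPositiveBlock_ketBra (x : Fin n → H) :
    IsPositiveBlock fun i j => ketBra (x i) (x j) := by
  refine isPositiveBlock_iff_posSemidef.2 fun v => ?_
  convert Matrix.posSemidef_vecMulVec_self_star fun i => ⟪v i, x i⟫_ℂ using 1
  ext i j
  simp [Matrix.vecMulVec_apply, mul_comm]

theorem IsPositiveBlock.add (hA : IsPositiveBlock A) (hB : IsPositiveBlock B) :
    IsPositiveBlock fun i j => A i j + B i j := fun v => by
  simpa [inner_add_right, Finset.sum_add_distrib] using add_nonneg (hA v) (hB v)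

theorem IsPositiveBlock.eq_smul_ketBra {A : Fin 2 → Fin 2 → traceClass H} (hA : IsPositiveBlock A)
    {x y : H} (hx : ‖x‖ = 1) (hy : ‖y‖ = 1) (h₀ : A 0 0 = ketBra x x) (h₁ : A 1 1 = ketBra y y) :
    A 0 1 = ⟪x, (A 0 1 : H →L[ℂ] H) y⟫_ℂ • ketBra x y := by
  have hM (v w : H) := isPositiveBlock_iff_posSemidef.1 hA ![v, w]
  have hleft (v w : H) (hv : ⟪x, v⟫_ℂ = 0) : ⟪v, (A 0 1 : H →L[ℂ] H) w⟫_ℂ = 0 := by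
    have h10 := apply_eq_zero_of_posSemidef (hM v w) (i := 0) (by simp [h₀, hv]) 1
    have := (hM v w).isHermitian.apply 0 1
    rw [h10] at this
    simpa using this.symm
  have hright (v w : H) (hw : ⟪y, w⟫_ℂ = 0) : ⟪v, (A 0 1 : H →L[ℂ] H) w⟫_ℂ = 0 := by
    simpa using apply_eq_zero_of_posSemidef (hM v w) (i := 1) (by simp [h₁, hw]) 0
  ext w
  refine ext_inner_left ℂ fun v => ?_
  have hl := hleft (v - ⟪x, v⟫_ℂ • x) w (by simp [hx])
  have hr := hright x (w - ⟪y, w⟫_ℂ • y) (by simp [hy])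
  simp only [inner_sub_left, inner_smul_left, map_sub, map_smul, inner_sub_right,
    inner_smul_right, inner_conj_symm] at hl hr
  simp only [Submodule.coe_smul, smul_apply, ketBra_apply, inner_smul_right]
  linear_combination hl + ⟪v, x⟫_ℂ * hr

variable [CompleteSpace H] [CompleteSpace K]

theorem IsPositiveBlock.krausMap (hA : IsPositiveBlock A) (T : H →L[ℂ] K) :
    IsPositiveBlock fun i j => krausMap T (A i j) := fun v => by
  simpa [krausMap_apply_apply, ContinuousLinearMap.adjoint_inner_left] using
    hA fun i => ContinuousLinearMap.adjoint T (v i)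

theorem IsPositiveBlock.posSemidef_traceLinearMap (hA : IsPositiveBlock A) :
    (of fun i j => traceLinearMap H (A i j)).PosSemidef := by
  obtain ⟨_, b, -⟩ := exists_hilbertBasis ℂ H
  refine posSemidef_of_dotProduct_mulVec_nonneg fun c => ?_
  refine (hasSum_sum fun i _ => (hasSum_sum fun j _ =>
    (hasSum_trace b (A i j)).mul_right (c j)).mul_left (star (c i))).nonneg fun l => ?_
  exact (isPositiveBlock_iff_posSemidef.1 hA fun _ => b l).dotProduct_mulVec_nonneg c

theorem IsPositiveBlock.traceLinearMap_smul (hA : IsPositiveBlock A) {τ : traceClass K}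
    (hτ : (τ : K →L[ℂ] K).IsPositive) :
    IsPositiveBlock fun i j => traceLinearMap H (A i j) • τ := by
  refine isPositiveBlock_iff_posSemidef.2 fun v => ?_
  simpa [Matrix.hadamard] using!
    hA.posSemidef_traceLinearMap.hadamard (posSemidef_inner_apply_of_isPositive hτ v)

end PositiveBlock

section Representation

variable {G H K : Type*} [Group G] [TopologicalSpace G]
  [NormedAddCommGroup H] [InnerProductSpace ℂ H] [CompleteSpace H]
  [NormedAddCommGroup K] [InnerProductSpace ℂ K] [CompleteSpace K]

namespace UnitaryRep

variable (U : UnitaryRep G H)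

theorem op_mul_apply (g h : G) (v : H) : U.op (g * h) v = U.op g (U.op h v) := by
  simp [op]

@[simp]
theorem op_one_apply (v : H) : U.op 1 v = v := by
  simp [op]

theorem op_apply_op_inv_apply (g : G) (v : H) : U.op g (U.op g⁻¹ v) = v := by
  rw [← op_mul_apply, mul_inv_cancel, op_one_apply]

theorem adjoint_op (g : G) : ContinuousLinearMap.adjoint (U.op g) = U.op g⁻¹ := by
  simp only [op, map_inv]
  rfl

theorem adjoint_op_comp_op (g : G) :
    ContinuousLinearMap.adjoint (U.op g) ∘L U.op g = .id ℂ H :=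
  Unitary.coe_star_mul_self (U.toHom g)

@[simp]
theorem norm_op_apply (g : G) (v : H) : ‖U.op g v‖ = ‖v‖ :=
  Unitary.norm_map (U.toHom g) v

theorem inner_op_op (g h : G) (v w : H) : ⟪U.op g v, U.op h w⟫_ℂ = ⟪v, U.op (g⁻¹ * h) w⟫_ℂ := by
  rw [op_mul_apply, ← adjoint_op, ContinuousLinearMap.adjoint_inner_right]

theorem continuous_op_apply (v : H) : Continuous fun g => U.op g v :=
  U.continuous_apply v

variable {U} in
theorem starProjection_comp_op {F : Submodule ℂ H} [F.HasOrthogonalProjection]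
    (hF : ∀ g, ∀ v ∈ F, U.op g v ∈ F) (g : G) :
    F.starProjection ∘L U.op g = U.op g ∘L F.starProjection := by
  ext v
  refine Submodule.eq_starProjection_of_mem_orthogonal
    (hF g _ (F.starProjection_apply_mem v)) fun u hu => ?_
  change ⟪u, U.op g v - U.op g (F.starProjection v)⟫_ℂ = 0
  rw [← map_sub, ← ContinuousLinearMap.adjoint_inner_left, adjoint_op]
  exact F.sub_starProjection_mem_orthogonal v _ (hF g⁻¹ u hu)

/-- The tensor product `η ⊗ U` of a unitary representation with a continuous character. -/
noncomputable def twist (η : G →ₜ* Circle) : UnitaryRep G H where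
  toHom :=
    { toFun := fun g => ⟨(η g : ℂ) • U.op g, Unitary.smul_mem_of_mem
        (by simp [Unitary.mem_iff, ← Circle.coe_inv_eq_conj]) (U.toHom g).2⟩
      map_one' := Subtype.ext <| by ext v; simp
      map_mul' := fun g h => Subtype.ext <| by ext v; simp [op_mul_apply, smul_smul, mul_comm] }
  continuous_apply v :=
    (continuous_subtype_val.comp η.continuous_toFun).smul (U.continuous_apply v)

theorem op_twist (η : G →ₜ* Circle) (g : G) : (U.twist η).op g = (η g : ℂ) • U.op g :=
  rfl

end UnitaryRep

theorem continuous_charFunction (U : UnitaryRep G H) (ψ : H) : Continuous (charFunction U ψ) :=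
  continuous_const.inner (U.continuous_op_apply ψ)

theorem charFunction_one (U : UnitaryRep G H) {ψ : H} (hψ : ‖ψ‖ = 1) : charFunction U ψ 1 = 1 := by
  simp [charFunction, hψ]

theorem charFunction_twist (U : UnitaryRep G H) (η : G →ₜ* Circle) (ψ : H) (g : G) :
    charFunction (U.twist η) ψ g = charFunction U ψ g * (η g : ℂ) := by
  simp [charFunction, UnitaryRep.op_twist, mul_comm]

theorem conjBy_op_twist (U : UnitaryRep G H) (η : G →ₜ* Circle) (g : G) (A : traceClass H) :
    conjBy ((U.twist η).op g) A = conjBy (U.op g) A := by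
  rw [conjBy_eq_krausMap, U.op_twist, krausMap_circle_smul, conjBy_eq_krausMap]

theorem gEquivalent_twist_iff {U : UnitaryRep G H} {V : UnitaryRep G K} {η : G →ₜ* Circle}
    {ρ : traceClass H} {σ : traceClass K} :
    GEquivalent U (V.twist η) ρ σ ↔ GEquivalent U V ρ σ := by
  simp only [GEquivalent, CovariantlyConvertible, IsCovariant, conjBy_op_twist]

end Representation

section PositiveDefinite

variable {G : Type*} [Group G]

/-- A positive definite function on a group, normalized at the identity. The kernel is
`(g, h) ↦ f (g⁻¹ h)`, so the diagonal coefficient `g ↦ ⟨v|U(g)|v⟩` of a unitary representation at a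
unit vector is an instance. -/
structure IsNormalizedPositiveDefinite (f : G → ℂ) : Prop where
  map_one : f 1 = 1
  posSemidef : (Matrix.of fun g h => f (g⁻¹ * h)).PosSemidef

namespace IsNormalizedPositiveDefinite

variable {f : G → ℂ} (hf : IsNormalizedPositiveDefinite f)

include hf

theorem norm_le_one (g : G) : ‖f g‖ ≤ 1 := by
  simpa using norm_apply_le_one_of_posSemidef hf.posSemidef (by simp [hf.map_one]) 1 g

theorem map_mul_of_norm_eq_one (g : G) {h : G} (hh : ‖f h‖ = 1) : f (g * h) = f g * f h := by
  simpa using apply_eq_mul_of_posSemidef hf.posSemidef (by simp [hf.map_one])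
    (i := 1) (j := h) (by simpa using hh) g⁻¹

/-- The subgroup on which a normalized positive definite function has modulus one; the function is
multiplicative there. -/
def unimodularSubgroup : Subgroup G where
  carrier := {g | ‖f g‖ = 1}
  one_mem' := by simp [hf.map_one]
  mul_mem' {g h} (hg : ‖f g‖ = 1) (hh : ‖f h‖ = 1) := by
    simp [hf.map_mul_of_norm_eq_one g hh, hg, hh]
  inv_mem' {g} (hg : ‖f g‖ = 1) := by
    have h := hf.map_mul_of_norm_eq_one g⁻¹ hg
    rw [inv_mul_cancel, hf.map_one] at h
    simpa [hg] using (congrArg norm h).symm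

theorem norm_eq_one_of_connectedSpace [TopologicalSpace G] [IsTopologicalGroup G]
    [ConnectedSpace G] (h : ∀ᶠ g in nhds 1, ‖f g‖ = 1) (g : G) : ‖f g‖ = 1 := by
  have hopen : IsOpen (hf.unimodularSubgroup : Set G) := Subgroup.isOpen_of_mem_nhds _ h
  have huniv := IsClopen.eq_univ ⟨Subgroup.isClosed_of_isOpen _ hopen, hopen⟩ ⟨1, one_mem _⟩
  exact huniv.ge (Set.mem_univ g)

theorem exists_monoidHom_circle (hnorm : ∀ g, ‖f g‖ = 1) :
    ∃ η : G →* Circle, ∀ g, (η g : ℂ) = f g :=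
  ⟨{  toFun := fun g => ⟨f g, mem_sphere_zero_iff_norm.2 (hnorm g)⟩
      map_one' := Circle.ext hf.map_one
      map_mul' := fun g h => Circle.ext (hf.map_mul_of_norm_eq_one g (hnorm h)) }, fun _ => rfl⟩

end IsNormalizedPositiveDefinite

theorem continuous_circle_of_eq_mul [TopologicalSpace G] [IsTopologicalGroup G] (η : G →* Circle)
    {a b : G → ℂ} (ha : Continuous a) (hb : Continuous b) (hb1 : b 1 ≠ 0)
    (h : ∀ g, a g = b g * η g) : Continuous η := by
  have hcoe : Topology.IsInducing fun z : Circle => (z : ℂ) := ⟨rfl⟩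
  refine continuous_of_continuousAt_one η (hcoe.continuousAt_iff.2 ?_)
  refine (ha.continuousAt.div hb.continuousAt hb1).congr ?_
  filter_upwards [hb.continuousAt.eventually_ne hb1] with g hg
  rw [Pi.div_apply, h g, mul_div_cancel_left₀ _ hg]
  rfl

end PositiveDefinite

section CharacterOfGEquivalent

variable {H K : Type*}
  [NormedAddCommGroup H] [InnerProductSpace ℂ H] [CompleteSpace H]
  [NormedAddCommGroup K] [InnerProductSpace ℂ K] [CompleteSpace K]

theorem IsQuantumChannel.posSemidef_inner_map_ketBra {Φ : traceClass H →ₗ[ℂ] traceClass K}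
    (hΦ : IsQuantumChannel Φ) {ι : Type*} (x : ι → H) (y : ι → K) :
    (Matrix.of fun i j => ⟪y i, (Φ (ketBra (x i) (x j)) : K →L[ℂ] K) (y j)⟫_ℂ).PosSemidef :=
  posSemidef_of_forall_fin_submatrix fun n e => isPositiveBlock_iff_posSemidef.1
    (hΦ.completelyPositive n _ (isPositiveBlock_ketBra (x ∘ e))) (y ∘ e)

theorem IsQuantumChannel.inner_eq_mul_inner {Φ : traceClass H →ₗ[ℂ] traceClass K}
    (hΦ : IsQuantumChannel Φ) {x x' : H} {y y' : K} (hy : ‖y‖ = 1) (hy' : ‖y'‖ = 1)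
    (h : Φ (ketBra x x) = ketBra y y) (h' : Φ (ketBra x' x') = ketBra y' y') :
    ⟪x', x⟫_ℂ = ⟪y, (Φ (ketBra x x') : K →L[ℂ] K) y'⟫_ℂ * ⟪y', y⟫_ℂ := by
  have hblock := hΦ.completelyPositive 2 _ (isPositiveBlock_ketBra ![x, x'])
  have hoff : Φ (ketBra x x') = ⟪y, (Φ (ketBra x x') : K →L[ℂ] K) y'⟫_ℂ • ketBra y y' :=
    hblock.eq_smul_ketBra hy hy' h h'
  calc ⟪x', x⟫_ℂ = traceLinearMap H (ketBra x x') := (traceLinearMap_ketBra x x').symm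
    _ = traceLinearMap K (Φ (ketBra x x')) := (hΦ.tracePreserving _).symm
    _ = ⟪y, (Φ (ketBra x x') : K →L[ℂ] K) y'⟫_ℂ * ⟪y', y⟫_ℂ := by
      conv_lhs => rw [hoff, map_smul, traceLinearMap_ketBra, smul_eq_mul]

variable {G : Type*} [Group G] [TopologicalSpace G] {U : UnitaryRep G H} {V : UnitaryRep G K}
  {Φ : traceClass H →ₗ[ℂ] traceClass K} {ψ : H} {φ : K}

variable (U V Φ ψ φ) in
/-- The coefficient of `V(g)|φ⟩⟨φ|` in `Φ(U(g)|ψ⟩⟨ψ|)`, a function of `g`. For a channel that sends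
the orbit of `ψ` to the orbit of `φ` it is the ratio of the two characteristic functions. -/
noncomputable def transitionFunction (g : G) : ℂ :=
  ⟪V.op g φ, (Φ (ketBra (U.op g ψ) ψ) : K →L[ℂ] K) φ⟫_ℂ

theorem IsCovariant.map_ketBra_op (hcov : IsCovariant U V Φ) (g : G) (x y : H) :
    Φ (ketBra (U.op g x) (U.op g y)) = krausMap (V.op g) (Φ (ketBra x y)) := by
  rw [← krausMap_ketBra]
  exact hcov g _

theorem IsCovariant.transitionFunction_inv_mul (hcov : IsCovariant U V Φ) (g h : G) :
    transitionFunction U V Φ ψ φ (g⁻¹ * h) =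
      ⟪V.op h φ, (Φ (ketBra (U.op h ψ) (U.op g ψ)) : K →L[ℂ] K) (V.op g φ)⟫_ℂ := by
  have hψ : U.op h ψ = U.op g (U.op (g⁻¹ * h) ψ) := by rw [← U.op_mul_apply, mul_inv_cancel_left]
  have hφ : V.op g⁻¹ (V.op g φ) = φ := by rw [← V.op_mul_apply, inv_mul_cancel, V.op_one_apply]
  rw [hψ, hcov.map_ketBra_op, krausMap_apply_apply, V.adjoint_op, hφ,
    ← ContinuousLinearMap.adjoint_inner_left, V.adjoint_op, ← V.op_mul_apply]
  rfl

theorem IsCovariant.isNormalizedPositiveDefinite_transitionFunction (hcov : IsCovariant U V Φ)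
    (hΦ : IsQuantumChannel Φ) (hφ : ‖φ‖ = 1) (hst : Φ (pureState ψ) = pureState φ) :
    IsNormalizedPositiveDefinite (transitionFunction U V Φ ψ φ) where
  map_one := by
    have hst : Φ (ketBra ψ ψ) = ketBra φ φ := hst
    simp [transitionFunction, hst, hφ]
  posSemidef := by
    simp only [hcov.transitionFunction_inv_mul]
    exact (hΦ.posSemidef_inner_map_ketBra (U.op · ψ) (V.op · φ)).transpose

theorem IsCovariant.charFunction_eq_mul_transitionFunction (hcov : IsCovariant U V Φ)
    (hΦ : IsQuantumChannel Φ) (hφ : ‖φ‖ = 1) (hst : Φ (pureState ψ) = pureState φ) (g : G) :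
    charFunction U ψ g = charFunction V φ g * transitionFunction U V Φ ψ φ g := by
  have hg : Φ (ketBra (U.op g ψ) (U.op g ψ)) = ketBra (V.op g φ) (V.op g φ) := by
    rw [hcov.map_ketBra_op, ← krausMap_ketBra]
    exact congrArg _ hst
  rw [mul_comm]
  exact hΦ.inner_eq_mul_inner (by simpa using hφ) hφ hg hst

theorem CovariantlyConvertible.exists_isNormalizedPositiveDefinite
    (h : CovariantlyConvertible U V (pureState ψ) (pureState φ)) (hφ : ‖φ‖ = 1) :
    ∃ f : G → ℂ, IsNormalizedPositiveDefinite f ∧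
      ∀ g, charFunction U ψ g = charFunction V φ g * f g := by
  obtain ⟨Φ, hΦ, hcov, hst⟩ := h
  exact ⟨transitionFunction U V Φ ψ φ,
    hcov.isNormalizedPositiveDefinite_transitionFunction hΦ hφ hst,
    hcov.charFunction_eq_mul_transitionFunction hΦ hφ hst⟩

theorem GEquivalent.exists_isNormalizedPositiveDefinite
    (h : GEquivalent U V (pureState ψ) (pureState φ)) (hψ : ‖ψ‖ = 1) (hφ : ‖φ‖ = 1) :
    ∃ f : G → ℂ, IsNormalizedPositiveDefinite f ∧
      (∀ g, charFunction U ψ g = charFunction V φ g * f g) ∧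
      ∀ g, charFunction U ψ g ≠ 0 → ‖f g‖ = 1 := by
  obtain ⟨f, hf, hUV⟩ := h.1.exists_isNormalizedPositiveDefinite hφ
  obtain ⟨f', hf', hVU⟩ := h.2.exists_isNormalizedPositiveDefinite hψ
  refine ⟨f, hf, hUV, fun g hg => (hf.norm_le_one g).antisymm ?_⟩
  have hone : f' g * f g = 1 := by
    rw [← mul_eq_left₀ hg, ← mul_assoc, ← hVU, ← hUV]
  calc 1 = ‖f' g‖ * ‖f g‖ := by rw [← norm_mul, hone, norm_one]
    _ ≤ 1 * ‖f g‖ := by gcongr; exact hf'.norm_le_one g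
    _ = ‖f g‖ := one_mul _

theorem GEquivalent.exists_character [IsTopologicalGroup G]
    (h : GEquivalent U V (pureState ψ) (pureState φ)) (hψ : ‖ψ‖ = 1) (hφ : ‖φ‖ = 1)
    (hG : ConnectedSpace G ∨ ∀ g, charFunction U ψ g ≠ 0) :
    ∃ η : G →ₜ* Circle, ∀ g, charFunction U ψ g = charFunction V φ g * (η g : ℂ) := by
  obtain ⟨f, hf, hUV, hunim⟩ := h.exists_isNormalizedPositiveDefinite hψ hφ
  have hnorm : ∀ g, ‖f g‖ = 1 := by
    rcases hG with _ | hG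
    · refine hf.norm_eq_one_of_connectedSpace (.mono ?_ hunim)
      exact (continuous_charFunction U ψ).continuousAt.eventually_ne
        (by simp [charFunction_one U hψ])
    · exact fun g => hunim g (hG g)
  obtain ⟨η, hη⟩ := hf.exists_monoidHom_circle hnorm
  simp only [← hη] at hUV
  exact ⟨⟨η, continuous_circle_of_eq_mul η (continuous_charFunction U ψ)
    (continuous_charFunction V φ) (by simp [charFunction_one V hφ]) hUV⟩, hUV⟩

end CharacterOfGEquivalent

section InvariantState

open MeasureTheory InnerProductSpace

variable {G K : Type*} [Group G] [TopologicalSpace G]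
  [NormedAddCommGroup K] [InnerProductSpace ℂ K] [CompleteSpace K]

namespace UnitaryRep

variable (V : UnitaryRep G K)

theorem continuous_rankOne_op (φ : K) :
    Continuous fun g => rankOne ℂ (V.op g φ) (V.op g φ) :=
  (ContinuousLinearMap.smulRightL ℂ K K).continuous₂.comp
    (((innerSL ℂ).continuous.comp (V.continuous_op_apply φ)).prodMk (V.continuous_op_apply φ))

variable [MeasurableSpace G] (μ : Measure G)

/-- The average `∫ V(g)|φ⟩⟨φ|V(g)† dμ(g)` of a rank one operator over its orbit. For Haar measure
on a compact group this is a compact operator that commutes with the representation. -/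
noncomputable def orbitAverage (φ : K) : K →L[ℂ] K :=
  ∫ g, rankOne ℂ (V.op g φ) (V.op g φ) ∂μ

variable [CompactSpace G] [BorelSpace G] [IsProbabilityMeasure μ]

theorem integrable_rankOne_op (φ : K) :
    Integrable (fun g => rankOne ℂ (V.op g φ) (V.op g φ)) μ :=
  (V.continuous_rankOne_op φ).integrable_of_hasCompactSupport (.of_compactSpace _)

theorem integrable_inner_smul_op (φ v : K) :
    Integrable (fun g => ⟪V.op g φ, v⟫_ℂ • V.op g φ) μ :=
  (V.integrable_rankOne_op μ φ).apply_continuousLinearMap v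

theorem orbitAverage_apply (φ v : K) :
    V.orbitAverage μ φ v = ∫ g, ⟪V.op g φ, v⟫_ℂ • V.op g φ ∂μ :=
  ContinuousLinearMap.integral_apply (V.integrable_rankOne_op μ φ) v

theorem isCompactOperator_orbitAverage (φ : K) : IsCompactOperator (V.orbitAverage μ φ) := by
  have hrankOne (g : G) :
      rankOne ℂ (V.op g φ) (V.op g φ) ∈ compactOperator (RingHom.id ℂ) K K :=
    (isCompactOperator_of_locallyCompactSpace_dom
      (innerSL ℂ (V.op g φ))).clm_comp (.toSpanSingleton ℂ (V.op g φ))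
  exact Convex.integral_mem ((compactOperator (RingHom.id ℂ) K K).restrictScalars ℝ).convex
    isClosed_setOfPred_isCompactOperator (.of_forall hrankOne) (V.integrable_rankOne_op μ φ)

theorem isSymmetric_orbitAverage (φ : K) :
    (V.orbitAverage μ φ : K →ₗ[ℂ] K).IsSymmetric := by
  have hmem : V.orbitAverage μ φ ∈ (selfAdjoint (K →L[ℂ] K) : Set (K →L[ℂ] K)) :=
    Convex.integral_mem (selfAdjoint.submodule ℝ (K →L[ℂ] K)).convex
      (isClosed_eq continuous_star continuous_id)
      (.of_forall fun g => (isPositive_rankOne_self (V.op g φ)).isSelfAdjoint)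
      (V.integrable_rankOne_op μ φ)
  exact ContinuousLinearMap.isSelfAdjoint_iff_isSymmetric.1 hmem

theorem orbitAverage_op_apply [IsTopologicalGroup G] [μ.IsMulLeftInvariant] (φ : K) (h : G)
    (v : K) :
    V.orbitAverage μ φ (V.op h v) = V.op h (V.orbitAverage μ φ v) := by
  rw [orbitAverage_apply, orbitAverage_apply, ← ContinuousLinearMap.integral_comp_comm _
    (V.integrable_inner_smul_op μ φ v), ← integral_mul_left_eq_self _ h]
  congr 1 with g
  simp only [op_mul_apply, inner_op_op, inv_mul_cancel, op_one_apply, map_smul]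

theorem orbitAverage_ne_zero [μ.IsOpenPosMeasure] {φ : K} (hφ : φ ≠ 0) :
    V.orbitAverage μ φ ≠ 0 := by
  have hdiag : ⟪φ, V.orbitAverage μ φ φ⟫_ℂ = ((∫ g, ‖⟪φ, V.op g φ⟫_ℂ‖ ^ 2 ∂μ : ℝ) : ℂ) := by
    rw [orbitAverage_apply, ← integral_inner (V.integrable_inner_smul_op μ φ φ),
      ← integral_complex_ofReal]
    congr 1 with g
    rw [inner_smul_right, ← inner_conj_symm, Complex.conj_mul', Complex.ofReal_pow]
  have hpos : 0 < ∫ g, ‖⟪φ, V.op g φ⟫_ℂ‖ ^ 2 ∂μ := by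
    refine Continuous.integral_pos_of_hasCompactSupport_nonneg_nonzero (x := 1)
      ((continuous_const.inner (V.continuous_op_apply φ)).norm.pow 2) (.of_compactSpace _)
      (fun g => by positivity) ?_
    simpa using hφ
  intro h
  rw [h, zero_apply, inner_zero_right] at hdiag
  exact hpos.ne (by exact_mod_cast hdiag)

end UnitaryRep

variable [IsTopologicalGroup G] [CompactSpace G] [Nontrivial K]

theorem UnitaryRep.exists_finiteDimensional_invariant (V : UnitaryRep G K) :
    ∃ F : Submodule ℂ K, FiniteDimensional ℂ F ∧ F ≠ ⊥ ∧ ∀ g, ∀ v ∈ F, V.op g v ∈ F := by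
  obtain ⟨φ, hφ⟩ := exists_ne (0 : K)
  borelize G
  let μ : Measure G := .haarMeasure ⊤
  have : IsProbabilityMeasure μ := ⟨Measure.haarMeasure_self (K₀ := ⊤)⟩
  let T := V.orbitAverage μ φ
  have hcompact : IsCompactOperator T := V.isCompactOperator_orbitAverage μ φ
  obtain ⟨c, hc, hc0⟩ : ∃ c, Module.End.HasEigenvalue (T : K →ₗ[ℂ] K) c ∧ c ≠ 0 := by
    by_contra! h
    exact V.orbitAverage_ne_zero μ hφ <|
      (ContinuousLinearMap.eq_zero_of_forall_hasEigenvalue_eq_zero hcompact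
        (V.isSymmetric_orbitAverage μ φ)).1 h
  refine ⟨Module.End.eigenspace T.toLinearMap c,
    ContinuousLinearMap.finite_dimensional_eigenspace hcompact c hc0, hc, fun g v hv => ?_⟩
  rw [Module.End.mem_eigenspace_iff] at hv ⊢
  calc T (V.op g v) = V.op g (T v) := V.orbitAverage_op_apply μ φ g v
    _ = c • V.op g v := by rw [← map_smul]; exact congrArg _ hv

theorem UnitaryRep.exists_invariant_state (V : UnitaryRep G K) :
    ∃ τ : traceClass K, (τ : K →L[ℂ] K).IsPositive ∧ traceLinearMap K τ = 1 ∧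
      ∀ g, conjBy (V.op g) τ = τ := by
  obtain ⟨F, _, hF₀, hF⟩ := V.exists_finiteDimensional_invariant
  let b := stdOrthonormalBasis ℂ F
  let d : ℂ := Module.finrank ℂ F
  have hd : d ≠ 0 := Nat.cast_ne_zero.2 (mt Submodule.finrank_eq_zero.1 hF₀)
  let τ : traceClass K := d⁻¹ • ∑ k, ketBra (b k : K) (b k)
  have hτ : (τ : K →L[ℂ] K) = d⁻¹ • F.starProjection := by
    rw [b.starProjection_eq_sum_rankOne]
    simp [τ, ketBra]
  refine ⟨τ, ?_, ?_, fun g => ?_⟩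
  · rw [hτ]
    exact (ContinuousLinearMap.IsPositive.of_isStarProjection
      isStarProjection_starProjection).smul_of_nonneg (by simp [d])
  · have hb (k) : traceLinearMap K (ketBra (b k : K) (b k)) = 1 := by
      rw [traceLinearMap_ketBra, inner_self_eq_norm_sq_to_K, ← Submodule.coe_norm, b.norm_eq_one]
      simp
    rw [map_smul, map_sum, Finset.sum_congr rfl fun k _ => hb k]
    simpa [d] using inv_mul_cancel₀ hd
  · ext v
    have hcomm := DFunLike.congr_fun (starProjection_comp_op hF g) (V.op g⁻¹ v)
    simp only [ContinuousLinearMap.comp_apply, V.op_apply_op_inv_apply] at hcomm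
    simp [conjBy_eq_krausMap, krausMap_apply_apply, V.adjoint_op, hτ, hcomm]

end InvariantState

section Intertwiner

open ContinuousLinearMap (adjoint)

variable {H K : Type*}
  [NormedAddCommGroup H] [InnerProductSpace ℂ H] [CompleteSpace H]
  [NormedAddCommGroup K] [InnerProductSpace ℂ K] [CompleteSpace K]

omit [CompleteSpace H] [CompleteSpace K] in
theorem norm_linearCombination_eq_of_inner_eq {ι : Type*} {x : ι → H} {y : ι → K}
    (h : ∀ i j, ⟪x i, x j⟫_ℂ = ⟪y i, y j⟫_ℂ) (a : ι →₀ ℂ) :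
    ‖Finsupp.linearCombination ℂ y a‖ = ‖Finsupp.linearCombination ℂ x a‖ := by
  simp only [@norm_eq_sqrt_re_inner ℂ, Finsupp.linearCombination_apply, Finsupp.sum, sum_inner,
    inner_sum, inner_smul_left, inner_smul_right, h]

omit [CompleteSpace H] in
theorem exists_linearIsometry_of_inner_eq {ι : Type*} {x : ι → H} {y : ι → K}
    (h : ∀ i j, ⟪x i, x j⟫_ℂ = ⟪y i, y j⟫_ℂ) :
    ∃ T : (Submodule.span ℂ (Set.range x)).topologicalClosure →ₗᵢ[ℂ] K,
      ∀ i hi, T ⟨x i, hi⟩ = y i := by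
  let e := Finsupp.linearCombination ℂ x
  let f := Finsupp.linearCombination ℂ y
  set S := Submodule.span ℂ (Set.range x)
  have hrange : e.range = S := Finsupp.range_linearCombination ℂ
  let e' : (ι →₀ ℂ) →ₗ[ℂ] S.topologicalClosure :=
    e.codRestrict _ fun a => S.le_topologicalClosure (hrange ▸ e.mem_range_self a)
  have hdense : DenseRange e' := fun m => by
    have hm : (m : H) ∈ closure (e.range : Set H) := by rw [hrange]; exact m.2
    rwa [closure_subtype, ← Set.range_comp]
  have hnorm (a : ι →₀ ℂ) : ‖f a‖ = ‖e' a‖ := norm_linearCombination_eq_of_inner_eq h a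
  let T : S.topologicalClosure →L[ℂ] K := f.extendOfNorm e'
  have hT (a : ι →₀ ℂ) : T (e' a) = f a :=
    LinearMap.extendOfNorm_eq hdense ⟨1, fun a => by rw [hnorm, one_mul]⟩ a
  have hTnorm (m : S.topologicalClosure) : ‖T m‖ = ‖m‖ :=
    hdense.induction_on (p := fun m => ‖T m‖ = ‖m‖) m
      (isClosed_eq (by fun_prop) (by fun_prop)) fun a => by rw [hT, hnorm]
  refine ⟨⟨T, hTnorm⟩, fun i hi => ?_⟩
  have hi' : (⟨x i, hi⟩ : S.topologicalClosure) = e' (Finsupp.single i 1) :=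
    Subtype.ext (by simp [e', e])
  calc T ⟨x i, hi⟩ = f (Finsupp.single i 1) := by rw [hi', hT]
    _ = y i := by simp [f]

theorem exists_partialIsometry_of_inner_eq {ι : Type*} {x : ι → H} {y : ι → K}
    (h : ∀ i j, ⟪x i, x j⟫_ℂ = ⟪y i, y j⟫_ℂ) :
    ∃ W : H →L[ℂ] K, (∀ i, W (x i) = y i) ∧
      adjoint W ∘L W = (Submodule.span ℂ (Set.range x)).topologicalClosure.starProjection := by
  obtain ⟨T, hT⟩ := exists_linearIsometry_of_inner_eq h
  let M := (Submodule.span ℂ (Set.range x)).topologicalClosure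
  refine ⟨T.toContinuousLinearMap ∘L M.orthogonalProjectionOnto, fun i => ?_, ?_⟩
  · have hi : x i ∈ M := Submodule.le_topologicalClosure _ (Submodule.subset_span ⟨i, rfl⟩)
    rw [ContinuousLinearMap.comp_apply,
      Submodule.orthogonalProjectionOnto_mem_subspace_eq_self (⟨x i, hi⟩ : M)]
    exact hT i hi
  · ext v
    refine ext_inner_left ℂ fun w => ?_
    rw [ContinuousLinearMap.comp_apply, ContinuousLinearMap.adjoint_inner_right]
    calc ⟪T (M.orthogonalProjectionOnto w), T (M.orthogonalProjectionOnto v)⟫_ℂ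
        = ⟪M.starProjection w, M.starProjection v⟫_ℂ := T.inner_map_map _ _
      _ = ⟪w, M.starProjection v⟫_ℂ := by
        rw [Submodule.inner_starProjection_left_eq_right,
          Submodule.starProjection_eq_self_iff.2 (M.starProjection_apply_mem v)]

theorem comp_starProjection_eq_self {W : H →L[ℂ] K} {M : Submodule ℂ H}
    [M.HasOrthogonalProjection] (hW : adjoint W ∘L W = M.starProjection) :
    W ∘L M.starProjection = W := by
  ext v
  rw [ContinuousLinearMap.comp_apply, ← sub_eq_zero, ← map_sub, ← inner_self_eq_zero (𝕜 := ℂ),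
    ← ContinuousLinearMap.adjoint_inner_right, ← ContinuousLinearMap.comp_apply, hW, map_sub,
    Submodule.starProjection_eq_self_iff.2 (M.starProjection_apply_mem v), sub_self,
    inner_zero_right]

variable {G : Type*} [Group G] [TopologicalSpace G]

namespace UnitaryRep

/-- The cyclic subspace generated by a vector: the closed span of its orbit, which is the smallest
closed invariant subspace containing the vector. -/
def cyclicSubspace (U : UnitaryRep G H) (ψ : H) : Submodule ℂ H :=
  (Submodule.span ℂ (Set.range (U.op · ψ))).topologicalClosure

instance (U : UnitaryRep G H) (ψ : H) : CompleteSpace (U.cyclicSubspace ψ) :=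
  inferInstanceAs (CompleteSpace (Submodule.topologicalClosure _))

variable (U : UnitaryRep G H) (V : UnitaryRep G K) (ψ : H)

theorem op_mem_cyclicSubspace (g : G) : U.op g ψ ∈ U.cyclicSubspace ψ :=
  Submodule.le_topologicalClosure _ (Submodule.subset_span ⟨g, rfl⟩)

theorem op_apply_mem_cyclicSubspace (g : G) {v : H} (hv : v ∈ U.cyclicSubspace ψ) :
    U.op g v ∈ U.cyclicSubspace ψ := by
  refine Submodule.topologicalClosure_minimal
    (t := (U.cyclicSubspace ψ).comap (U.op g).toLinearMap) _ (Submodule.span_le.2 ?_)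
    ((Submodule.isClosed_topologicalClosure _).preimage (U.op g).continuous) hv
  rintro _ ⟨h, rfl⟩
  change U.op g (U.op h ψ) ∈ U.cyclicSubspace ψ
  rw [← op_mul_apply]
  exact U.op_mem_cyclicSubspace ψ (g * h)

variable {U V ψ} in
theorem exists_intertwiner_of_charFunction_eq {φ : K}
    (h : ∀ g, charFunction U ψ g = charFunction V φ g) :
    ∃ W : H →L[ℂ] K, W ψ = φ ∧ (∀ g, W ∘L U.op g = V.op g ∘L W) ∧
      adjoint W ∘L W = (U.cyclicSubspace ψ).starProjection := by
  obtain ⟨W, hWop, hWW⟩ := exists_partialIsometry_of_inner_eq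
    (x := (U.op · ψ)) (y := (V.op · φ)) fun g k => by
      rw [U.inner_op_op, V.inner_op_op]
      exact h (g⁻¹ * k)
  refine ⟨W, by simpa using hWop 1, fun g => ?_, hWW⟩
  have hcyc : Set.EqOn (W ∘L U.op g) (V.op g ∘L W) (U.cyclicSubspace ψ) := by
    refine ContinuousLinearMap.eqOn_closure_span ?_
    rintro _ ⟨k, rfl⟩
    simp only [ContinuousLinearMap.comp_apply, ← op_mul_apply, hWop]
  have hWP := comp_starProjection_eq_self hWW
  have hUP := starProjection_comp_op (fun g _ => U.op_apply_mem_cyclicSubspace ψ g) g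
  ext v
  calc W (U.op g v) = W ((U.cyclicSubspace ψ).starProjection (U.op g v)) :=
        (DFunLike.congr_fun hWP _).symm
    _ = W (U.op g ((U.cyclicSubspace ψ).starProjection v)) :=
        congrArg W (DFunLike.congr_fun hUP v)
    _ = V.op g (W ((U.cyclicSubspace ψ).starProjection v)) :=
        hcyc ((U.cyclicSubspace ψ).starProjection_apply_mem v)
    _ = V.op g (W v) := congrArg (V.op g) (DFunLike.congr_fun hWP v)

end UnitaryRep

end Intertwiner

section ResetChannel

open ContinuousLinearMap (adjoint)

variable {H K L : Type*}
  [NormedAddCommGroup H] [InnerProductSpace ℂ H] [CompleteSpace H]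
  [NormedAddCommGroup K] [InnerProductSpace ℂ K] [CompleteSpace K]
  [NormedAddCommGroup L] [InnerProductSpace ℂ L] [CompleteSpace L]

/-- The map `A ↦ W A W† + tr(Q A Q†) τ`: a two-outcome measurement with Kraus operators `W` and `Q`
that discards the system and prepares the state `τ` in the second outcome. -/
noncomputable def resetChannel (W : H →L[ℂ] K) (Q : H →L[ℂ] L) (τ : traceClass K) :
    traceClass H →ₗ[ℂ] traceClass K :=
  krausMap W + (traceLinearMap L ∘ₗ krausMap Q).smulRight τ

variable {W : H →L[ℂ] K} {Q : H →L[ℂ] L} {τ : traceClass K}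

theorem resetChannel_apply (A : traceClass H) :
    resetChannel W Q τ A = krausMap W A + traceLinearMap L (krausMap Q A) • τ :=
  rfl

theorem isQuantumChannel_resetChannel (hWQ : adjoint W ∘L W + adjoint Q ∘L Q = .id ℂ H)
    (hτ : (τ : K →L[ℂ] K).IsPositive) (hτ₁ : traceLinearMap K τ = 1) :
    IsQuantumChannel (resetChannel W Q τ) where
  completelyPositive _ _ hA := (hA.krausMap W).add ((hA.krausMap Q).traceLinearMap_smul hτ)
  tracePreserving A := by
    change traceLinearMap K (resetChannel W Q τ A) = traceLinearMap H A
    rw [resetChannel_apply, map_add, map_smul, hτ₁, smul_eq_mul, mul_one,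
      traceLinearMap_krausMap_add hWQ]

theorem resetChannel_pureState {ψ : H} {φ : K} (hW : W ψ = φ) (hQ : Q ψ = 0) :
    resetChannel W Q τ (pureState ψ) = pureState φ := by
  rw [resetChannel_apply, pureState_eq_ketBra, krausMap_ketBra, krausMap_ketBra, hW, hQ,
    traceLinearMap_ketBra, inner_zero_left, zero_smul, add_zero, pureState_eq_ketBra]

variable {G : Type*} [Group G] [TopologicalSpace G]

theorem isCovariant_resetChannel {U : UnitaryRep G H} {V : UnitaryRep G K} {X : UnitaryRep G L}
    (hW : ∀ g, W ∘L U.op g = V.op g ∘L W) (hQ : ∀ g, Q ∘L U.op g = X.op g ∘L Q)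
    (hτ : ∀ g, conjBy (V.op g) τ = τ) : IsCovariant U V (resetChannel W Q τ) := fun g A => by
  simp only [conjBy_eq_krausMap] at hτ ⊢
  rw [resetChannel_apply, krausMap_krausMap, krausMap_krausMap, hW, hQ, ← krausMap_krausMap,
    ← krausMap_krausMap, traceLinearMap_krausMap_of_isometry (X.adjoint_op_comp_op g),
    resetChannel_apply, map_add, map_smul, hτ]

end ResetChannel

section GEquivalentOfCharacter

open ContinuousLinearMap (adjoint)

variable {G H K : Type*} [Group G] [TopologicalSpace G] [IsTopologicalGroup G] [CompactSpace G]
  [NormedAddCommGroup H] [InnerProductSpace ℂ H] [CompleteSpace H]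
  [NormedAddCommGroup K] [InnerProductSpace ℂ K] [CompleteSpace K]
  {U : UnitaryRep G H} {V : UnitaryRep G K} {ψ : H} {φ : K}

theorem covariantlyConvertible_of_charFunction_eq (hφ : φ ≠ 0)
    (h : ∀ g, charFunction U ψ g = charFunction V φ g) :
    CovariantlyConvertible U V (pureState ψ) (pureState φ) := by
  have : Nontrivial K := ⟨φ, 0, hφ⟩
  obtain ⟨W, hWψ, hWU, hWW⟩ := UnitaryRep.exists_intertwiner_of_charFunction_eq h
  obtain ⟨τ, hτ, hτ₁, hτV⟩ := V.exists_invariant_state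
  set M := U.cyclicSubspace ψ
  have hMψ : ψ ∈ M := by simpa using U.op_mem_cyclicSubspace ψ 1
  have hPU := U.starProjection_comp_op fun g _ => U.op_apply_mem_cyclicSubspace ψ g
  have hQ : Mᗮ.starProjection = .id ℂ H - M.starProjection := by
    rw [Submodule.id_eq_sum_starProjection_self_orthogonalComplement (K := M), add_sub_cancel_left]
  refine ⟨resetChannel W Mᗮ.starProjection τ, isQuantumChannel_resetChannel ?_ hτ hτ₁,
    isCovariant_resetChannel hWU (X := U) (fun g => ?_) hτV, resetChannel_pureState hWψ ?_⟩
  · have hQQ : adjoint Mᗮ.starProjection ∘L Mᗮ.starProjection = Mᗮ.starProjection := by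
      have hproj : IsStarProjection Mᗮ.starProjection := isStarProjection_starProjection
      rw [← ContinuousLinearMap.star_eq_adjoint, hproj.isSelfAdjoint.star_eq]
      exact hproj.isIdempotentElem
    rw [hWW, hQQ, ← Submodule.id_eq_sum_starProjection_self_orthogonalComplement]
  · rw [hQ, ContinuousLinearMap.sub_comp, ContinuousLinearMap.comp_sub, hPU]
    rfl
  · simp [hQ, Submodule.starProjection_eq_self_iff.2 hMψ]

theorem gEquivalent_of_charFunction_eq (hψ : ψ ≠ 0) (hφ : φ ≠ 0)
    (h : ∀ g, charFunction U ψ g = charFunction V φ g) :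
    GEquivalent U V (pureState ψ) (pureState φ) :=
  ⟨covariantlyConvertible_of_charFunction_eq hφ h,
    covariantlyConvertible_of_charFunction_eq hψ fun g => (h g).symm⟩

theorem gEquivalent_of_character (hψ : ψ ≠ 0) (hφ : φ ≠ 0) (η : G →ₜ* Circle)
    (h : ∀ g, charFunction U ψ g = charFunction V φ g * (η g : ℂ)) :
    GEquivalent U V (pureState ψ) (pureState φ) :=
  gEquivalent_twist_iff.1 <| gEquivalent_of_charFunction_eq hψ hφ fun g =>
    (h g).trans (charFunction_twist V η φ g).symm

end GEquivalentOfCharacter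

end Asymmetry

theorem theorem3_general
    {G H K : Type*}
    [Group G] [TopologicalSpace G] [IsTopologicalGroup G] [CompactSpace G]
    [NormedAddCommGroup H] [InnerProductSpace ℂ H] [CompleteSpace H]
    [NormedAddCommGroup K] [InnerProductSpace ℂ K] [CompleteSpace K]
    (U : UnitaryRep G H) (V : UnitaryRep G K)
    (ψ : H) (φ : K) (hψ : ‖ψ‖ = 1) (hφ : ‖φ‖ = 1) :
    ((∃ η : G →ₜ* Circle, ∀ g, charFunction U ψ g = charFunction V φ g * (η g : ℂ)) →
      GEquivalent U V (pureState ψ) (pureState φ)) ∧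
    ((ConnectedSpace G ∨ ∀ g, charFunction U ψ g ≠ 0) →
      (GEquivalent U V (pureState ψ) (pureState φ) ↔
        ∃ η : G →ₜ* Circle, ∀ g, charFunction U ψ g = charFunction V φ g * (η g : ℂ))) := by
  have hψ₀ : ψ ≠ 0 := ne_zero_of_norm_ne_zero (hψ ▸ one_ne_zero)
  have hφ₀ : φ ≠ 0 := ne_zero_of_norm_ne_zero (hφ ▸ one_ne_zero)
  have hforward : (∃ η : G →ₜ* Circle, ∀ g, charFunction U ψ g = charFunction V φ g * (η g : ℂ)) →
      GEquivalent U V (pureState ψ) (pureState φ) :=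
    fun ⟨η, hη⟩ => gEquivalent_of_character hψ₀ hφ₀ η hη
  exact ⟨hforward, fun hG => ⟨fun h => h.exists_character hψ hφ hG, hforward⟩⟩

theorem theorem3
    {E G H K : Type*}
    [NormedAddCommGroup E] [NormedSpace ℝ E] [FiniteDimensional ℝ E]
    [Group G] [TopologicalSpace G] [T2Space G] [ChartedSpace E G] [LieGroup 𝓘(ℝ, E) ∞ G]
    [CompactSpace G]
    [NormedAddCommGroup H] [InnerProductSpace ℂ H] [CompleteSpace H]
    [NormedAddCommGroup K] [InnerProductSpace ℂ K] [CompleteSpace K]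
    (U : UnitaryRep G H) (V : UnitaryRep G K)
    (ψ : H) (φ : K) (hψ : ‖ψ‖ = 1) (hφ : ‖φ‖ = 1) :
    ((∃ η : G →ₜ* Circle, ∀ g, charFunction U ψ g = charFunction V φ g * (η g : ℂ)) →
      GEquivalent U V (pureState ψ) (pureState φ)) ∧
    ((ConnectedSpace G ∨ ∀ g, charFunction U ψ g ≠ 0 ∧ charFunction V φ g ≠ 0) →
      (GEquivalent U V (pureState ψ) (pureState φ) ↔
        ∃ η : G →ₜ* Circle, ∀ g, charFunction U ψ g = charFunction V φ g * (η g : ℂ))) := by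
  have : IsTopologicalGroup G := topologicalGroup_of_lieGroup 𝓘(ℝ, E) ∞
  exact (theorem3_general U V ψ φ hψ hφ).imp_right fun h hG =>
    h (hG.imp_right fun hne g => (hne g).1)
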